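/- Let $I^n=[0,1]^n$. A binary $n$-simplex is a nondegenerate $n$-simplex whose $n+1$ vertices are vertices of $I^n$; it is nonobtuse if none of its dihedral angles (the angle between two facets, equal to $\pi$ minus the angle between their outward normals) exceeds $\pi/2$. A nonobtuse binary triangulation of $I^n$ is a face-to-face partition of $I^n$ into nonobtuse binary $n$-simplices. Let $e_1^n,\dots,e_n^n$ be the standard basis of $\mathbb{R}^n$ and $e^n=(1,\dots,1)$. Let $\mathcal{T}_\mathcal{S}^n$ be the standard triangulation of $I^n$ into the $n!$ path simplices $\operatorname{conv}\{0,\ e^n_{\pi(1)},\ e^n_{\pi(1)}+e^n_{\pi(2)},\ \dots,\ e^n\}$, where $\pi$ runs over the permutations of $\{1,\dots,n\}$. Let $K^n=\operatorname{conv}\{0,e^n_1,\dots,e^n_n\}$ and $A^n=\operatorname{conv}\{e^n,e^n_1,\dots,e^n_n\}$. Define $\mathcal{T}_\mathcal{N}^1=\{K^1\}$ and, for $n\ge 2$, let $\mathcal{T}_\mathcal{N}^n$ consist of $K^n$, $A^n$ and all simplices $\operatorname{conv}(\iota_j(S)\cup\{e^n\})$ with $j\in\{1,\dots,n\}$ and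 $S\in\mathcal{T}_\mathcal{N}^{n-1}\setminus\{K^{n-1}\}$, where $\iota_j:\mathbb{R}^{n-1}\to\mathbb{R}^n$ inserts a zero as the $j$-th coordinate. **Theorem.** Up to the $4!\,2^4$ symmetries of the cube $I^4$, the only nonobtuse binary triangulations of $I^4$ are $\mathcal{T}_\mathcal{S}^4$ and $\mathcal{T}_\mathcal{N}^4$. That is, a set $\mathcal{T}$ of simplices is a nonobtuse binary triangulation of $I^4$ if and only if it is the image of $\mathcal{T}_\mathcal{S}^4$ or of $\mathcal{T}_\mathcal{N}^4$ under a symmetry of $I^4$. -/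

import Mathlib

noncomputable section

namespace NonobtuseCube

/-- A vertex of the unit cube `I^n = [0,1]^n`, given by its binary coordinates. -/
abbrev CubeVertex (n : ℕ) : Type := Fin n → Bool

/-- The cube vertex as a point of Euclidean space (`true` is the coordinate 1, `false` is 0). -/
def pt {n : ℕ} (v : CubeVertex n) : EuclideanSpace ℝ (Fin n) :=
  WithLp.toLp 2 (fun i => if v i then (1 : ℝ) else 0)

/-- The unit cube `I^n`. -/
def cube (n : ℕ) : Set (EuclideanSpace ℝ (Fin n)) :=
  {x | ∀ i, 0 ≤ x i ∧ x i ≤ 1}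

/-- The convex hull of a set of cube vertices. -/
def hull {n : ℕ} (S : Finset (CubeVertex n)) : Set (EuclideanSpace ℝ (Fin n)) :=
  convexHull ℝ (pt '' (S : Set (CubeVertex n)))

/-- `S` is the vertex set of a binary `n`-simplex: `n + 1` affinely independent vertices
of the `n`-cube. -/
def IsBinarySimplex {n : ℕ} (S : Finset (CubeVertex n)) : Prop :=
  S.card = n + 1 ∧ AffineIndependent ℝ (fun v : S => pt (v : CubeVertex n))

/-- `q` is an outward normal of the facet of `S` opposite the vertex `v`: it is orthogonal to
that facet, and `v` lies strictly on the negative side of the facet. For a nondegenerate simplex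
with at least two vertices it exists and is unique up to a positive factor. -/
def IsOutwardNormal {n : ℕ} (S : Finset (CubeVertex n)) (v : CubeVertex n)
    (q : EuclideanSpace ℝ (Fin n)) : Prop :=
  (∀ x ∈ S, ∀ y ∈ S, x ≠ v → y ≠ v → inner ℝ q (pt x - pt y) = 0) ∧
    ∀ x ∈ S, x ≠ v → inner ℝ q (pt v - pt x) < 0

/-- No dihedral angle of `S` is obtuse. The dihedral angle between two facets is `π` minus the
angle between their outward normals. -/
def IsNonobtuse {n : ℕ} (S : Finset (CubeVertex n)) : Prop :=
  ∀ v ∈ S, ∀ w ∈ S, v ≠ w → ∀ q r : EuclideanSpace ℝ (Fin n),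
    IsOutwardNormal S v q → IsOutwardNormal S w r →
      Real.pi - InnerProductGeometry.angle q r ≤ Real.pi / 2

/-- `T` is a binary triangulation of `I^n`: a face-to-face partition of `I^n` into nondegenerate
`n`-simplices whose vertices are vertices of `I^n`. -/
structure IsBinaryTriangulation {n : ℕ} (T : Finset (Finset (CubeVertex n))) : Prop where
  simplex : ∀ S ∈ T, IsBinarySimplex S
  cover : (⋃ S ∈ T, hull S) = cube n
  face_to_face : ∀ S ∈ T, ∀ S' ∈ T, hull S ∩ hull S' = hull (S ∩ S')

/-- A binary triangulation all of whose simplices are nonobtuse. -/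
def IsNonobtuseBinaryTriangulation {n : ℕ} (T : Finset (Finset (CubeVertex n))) : Prop :=
  IsBinaryTriangulation T ∧ ∀ S ∈ T, IsNonobtuse S

/-- The path simplex with orthogonal path
`0, e_{σ⁻¹ 0}, e_{σ⁻¹ 0} + e_{σ⁻¹ 1}, …, (1, …, 1)`. -/
def pathSimplex {n : ℕ} (σ : Equiv.Perm (Fin n)) : Finset (CubeVertex n) :=
  (Finset.univ : Finset (Fin (n + 1))).image
    (fun (k : Fin (n + 1)) (i : Fin n) => decide ((σ i : ℕ) < (k : ℕ)))

/-- The standard triangulation `T_S^n` of `I^n`, into the `n!` path simplices that have the long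
diagonal from `0` to `(1, …, 1)` as an edge. -/
def standardTriangulation (n : ℕ) : Finset (Finset (CubeVertex n)) :=
  Finset.univ.image pathSimplex

/-- The origin. -/
def origin (n : ℕ) : CubeVertex n := fun _ => false

/-- The all-ones vertex `e^n`. -/
def allOnes (n : ℕ) : CubeVertex n := fun _ => true

/-- The standard basis vector `e_j`. -/
def basisVertex {n : ℕ} (j : Fin n) : CubeVertex n := fun i => decide (i = j)

/-- The cube corner `K^n` at the origin. -/
def cubeCorner (n : ℕ) : Finset (CubeVertex n) :=
  insert (origin n) (Finset.univ.image basisVertex)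

/-- The antipodal `A^n` of `K^n`: the hull of the interior facet of `K^n` and `e^n`. -/
def antipodal (n : ℕ) : Finset (CubeVertex n) :=
  insert (allOnes n) (Finset.univ.image basisVertex)

/-- The cone towards `e^{n+1}` of the copy of `S` in the facet `C_j = {x_j = 0}` of `I^{n+1}`. -/
def coneFacet {n : ℕ} (j : Fin (n + 1)) (S : Finset (CubeVertex n)) :
    Finset (CubeVertex (n + 1)) :=
  insert (allOnes (n + 1)) (S.image (fun v => Fin.insertNth j false v))

/-- The triangulation `T_N^n` of `I^n`: the cube corner `K^n`, and the result of coning off the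
rest of `I^n` towards `e^n`, where each facet `C_j` not containing `e^n` carries a copy of
`T_N^{n-1}` and the remaining facet (the interior facet of `K^n`) yields `A^n`. -/
def coneTriangulation : (n : ℕ) → Finset (Finset (CubeVertex n))
  | 0 => {cubeCorner 0}
  | 1 => {cubeCorner 1}
  | n + 2 => {cubeCorner (n + 2), antipodal (n + 2)} ∪
      (Finset.univ : Finset (Fin (n + 2))).biUnion (fun j =>
        ((coneTriangulation (n + 1)).erase (cubeCorner (n + 1))).image (coneFacet j))

/-- The symmetry of `I^n` that permutes the coordinates by `σ` and then reflects
(`x_i ↦ 1 - x_i`) the coordinates `i` with `b i = true`. These are all `n! 2^n` symmetries. -/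
def cubeSymmetry {n : ℕ} (σ : Equiv.Perm (Fin n)) (b : Fin n → Bool) (v : CubeVertex n) :
    CubeVertex n :=
  fun i => xor (v (σ i)) (b i)

/-- `T` is the image of `T₀` under a symmetry of the cube. -/
def IsCopyOf {n : ℕ} (T T₀ : Finset (Finset (CubeVertex n))) : Prop :=
  ∃ (σ : Equiv.Perm (Fin n)) (b : Fin n → Bool),
    T = T₀.image (fun S => S.image (cubeSymmetry σ b))

end NonobtuseCube

end

noncomputable section

namespace NonobtuseCube

open Finset

variable {n : ℕ}

/-! Two finite facts carry the theorem. First, up to reflections of the cube, every nonobtuse binary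
4-simplex belongs to one of the two triangulations (`exists_reflection`, resting on
`classification_codes`). Second, each of the two is rigid: any nonobtuse binary simplex sharing an
interior facet with one of its simplices is itself one of its simplices (`TableOK.closed`). If a
nonobtuse triangulation `T` has a simplex in a table, then the simplices common to both are closed
under crossing interior facets, since `IsBinaryTriangulation.exists_neighbor` supplies a neighbour
in `T` and rigidity puts it in the table. Such a family covers the cube, so it exhausts both `T` and
the table (`TableOK.eq_of_mem`).

The covering step, and the fact that the tables are triangulations at all, come from regularity.
Each table has a height function on the cube vertices and, for every simplex, an affine function
equal to the heights on that simplex and strictly below them elsewhere (`IsLift`). This certificate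
yields face-to-face intersections (`IsLift.face_to_face`) and covering (`IsLift.cover`): among
simplices closed under crossing, the one whose affine function is largest at `x` contains `x`. The
certificate passes to subfamilies, so no volume or connectedness argument is needed.

Angles are tested over the integers, with cross products as facet normals. -/

lemma pt_apply (v : CubeVertex n) (i : Fin n) : pt v i = if v i then (1 : ℝ) else 0 := rfl

lemma pt_injective : Function.Injective (pt : CubeVertex n → EuclideanSpace ℝ (Fin n)) := by
  intro u v h
  funext i
  have := congrArg (fun x : EuclideanSpace ℝ (Fin n) => x i) h
  simp only [pt_apply] at this
  cases hu : u i <;> cases hv : v i <;> simp_all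

/-! ### Convex hulls of cube vertices and barycentric coordinates -/

lemma mem_hull_iff {S : Finset (CubeVertex n)} {x : EuclideanSpace ℝ (Fin n)} :
    x ∈ hull S ↔ ∃ w : CubeVertex n → ℝ, (∀ v ∈ S, 0 ≤ w v) ∧ ∑ v ∈ S, w v = 1 ∧
      ∑ v ∈ S, w v • pt v = x := by
  classical
  have himg : pt '' (S : Set (CubeVertex n)) = ((S.image pt : Finset _) : Set _) := by simp
  rw [hull, himg, Finset.mem_convexHull']
  constructor
  · rintro ⟨w, h0, h1, hx⟩
    refine ⟨fun v => w (pt v), fun v hv => h0 _ (mem_image_of_mem _ hv), ?_, ?_⟩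
    · rwa [sum_image (pt_injective.injOn)] at h1
    · rwa [sum_image (pt_injective.injOn)] at hx
  · rintro ⟨w, h0, h1, hx⟩
    have hw : ∀ v, w (Function.invFun pt (pt v)) = w v := fun v => by
      rw [Function.leftInverse_invFun pt_injective v]
    refine ⟨fun y => w (Function.invFun pt y), ?_, ?_, ?_⟩
    · intro y hy
      obtain ⟨v, hv, rfl⟩ := mem_image.1 hy
      simpa only [hw] using h0 v hv
    · rw [sum_image (pt_injective.injOn)]; simpa only [hw] using h1
    · rw [sum_image (pt_injective.injOn)]; simpa only [hw] using hx

lemma isCompact_hull (S : Finset (CubeVertex n)) : IsCompact (hull S) :=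
  (S.finite_toSet.image pt).isCompact_convexHull ℝ

lemma hull_subset_cube (S : Finset (CubeVertex n)) : hull S ⊆ cube n := by
  refine convexHull_min ?_ ?_
  · rintro _ ⟨v, -, rfl⟩ i
    rw [pt_apply]
    split <;> norm_num
  · intro x hx y hy a b ha hb hab i
    have h1 := hx i
    have h2 := hy i
    simp only [PiLp.add_apply, PiLp.smul_apply, smul_eq_mul]
    constructor
    · nlinarith [mul_nonneg ha h1.1, mul_nonneg hb h2.1]
    · nlinarith [mul_le_mul_of_nonneg_left h1.2 ha, mul_le_mul_of_nonneg_left h2.2 hb]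

/-- An affine function of a combination with weights of sum one. -/
lemma affineMap_sum_smul {ι E : Type*} [AddCommGroup E] [Module ℝ E] (f : E →ᵃ[ℝ] ℝ)
    (s : Finset ι) (w : ι → ℝ) (p : ι → E) (hw : ∑ i ∈ s, w i = 1) :
    f (∑ i ∈ s, w i • p i) = ∑ i ∈ s, w i * f (p i) := by
  obtain ⟨c, hf⟩ : ∃ c, ∀ x, f x = f.linear x + c := ⟨f 0, fun x => by
    simpa using f.map_vadd 0 x⟩
  simp only [hf, map_sum, map_smul, smul_eq_mul, mul_add, sum_add_distrib, ← sum_mul, hw, one_mul]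

/-- `β` gives the barycentric coordinates of a nondegenerate simplex with vertex set `S`. -/
structure IsBarycentric (S : Finset (CubeVertex n))
    (β : CubeVertex n → EuclideanSpace ℝ (Fin n) →ᵃ[ℝ] ℝ) : Prop where
  self : ∀ v ∈ S, β v (pt v) = 1
  ne : ∀ u ∈ S, ∀ v ∈ S, u ≠ v → β u (pt v) = 0
  sum_eq_one : ∀ x, ∑ v ∈ S, β v x = 1
  sum_smul : ∀ x, ∑ v ∈ S, β v x • pt v = x

lemma IsBinarySimplex.exists_isBarycentric {S : Finset (CubeVertex n)} (hS : IsBinarySimplex S) :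
    ∃ β, IsBarycentric S β := by
  classical
  have htop : affineSpan ℝ (Set.range fun v : S => pt (v : CubeVertex n)) = ⊤ := by
    rw [hS.2.affineSpan_eq_top_iff_card_eq_finrank_add_one]
    simp [hS.1]
  let b : AffineBasis S ℝ (EuclideanSpace ℝ (Fin n)) := ⟨fun v => pt v, hS.2, htop⟩
  have hb : ∀ v : S, b v = pt (v : CubeVertex n) := fun _ => rfl
  let β : CubeVertex n → EuclideanSpace ℝ (Fin n) →ᵃ[ℝ] ℝ :=
    -- The value 0 off `S` is arbitrary: `IsBarycentric` constrains `β v` only for `v ∈ S`.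
    fun v => if h : v ∈ S then b.coord ⟨v, h⟩ else 0
  have hβ : ∀ v : S, β v = b.coord v := fun v => by simp [β]
  refine ⟨β, ?_, ?_, ?_, ?_⟩
  · intro v hv
    rw [hβ ⟨v, hv⟩, ← hb ⟨v, hv⟩, b.coord_apply_eq]
  · intro u hu v hv huv
    rw [hβ ⟨u, hu⟩, ← hb ⟨v, hv⟩, b.coord_apply_ne (by simpa using huv)]
  · intro x
    rw [← sum_coe_sort S, ← b.sum_coord_apply_eq_one x]
    exact sum_congr rfl fun v _ => by rw [hβ]
  · intro x
    rw [← sum_coe_sort S (fun v => β v x • pt v)]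
    conv_rhs => rw [← b.linear_combination_coord_eq_self x]
    exact sum_congr rfl fun v _ => by rw [hβ, hb]

/-- Applying `β u` to an affine dependence kills every term except the one at `u`, so that weight
vanishes. -/
lemma IsBinarySimplex.of_dual {S : Finset (CubeVertex n)} (hcard : S.card = n + 1)
    (β : CubeVertex n → EuclideanSpace ℝ (Fin n) →ᵃ[ℝ] ℝ)
    (hself : ∀ v ∈ S, β v (pt v) ≠ 0) (hne : ∀ u ∈ S, ∀ v ∈ S, u ≠ v → β u (pt v) = 0) :
    IsBinarySimplex S := by
  classical
  refine ⟨hcard, ?_⟩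
  rw [affineIndependent_iff]
  intro s w hw hsum u hu
  obtain ⟨c, hf⟩ : ∃ c, ∀ x, β u x = (β u).linear x + c := ⟨β u 0, fun x => by
    simpa using (β u).map_vadd 0 x⟩
  have h1 : ∑ v ∈ s, w v * β u (pt v) = 0 := by
    have h2 : (β u).linear (∑ v ∈ s, w v • pt (v : CubeVertex n)) = 0 := by
      rw [hsum, map_zero]
    simp only [map_sum, map_smul, smul_eq_mul] at h2
    simp only [hf, mul_add, sum_add_distrib, ← sum_mul, hw, zero_mul, add_zero]
    exact h2
  rw [sum_eq_single_of_mem u hu] at h1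
  · exact (mul_eq_zero.1 h1).resolve_right (hself u u.2)
  · intro v _ hvu
    rw [hne u u.2 v v.2 (fun h => hvu (Subtype.ext h.symm)), mul_zero]

namespace IsBarycentric

variable {S : Finset (CubeVertex n)} {β : CubeVertex n → EuclideanSpace ℝ (Fin n) →ᵃ[ℝ] ℝ}

lemma affine_apply (hβ : IsBarycentric S β) (f : EuclideanSpace ℝ (Fin n) →ᵃ[ℝ] ℝ)
    (x : EuclideanSpace ℝ (Fin n)) : f x = ∑ v ∈ S, β v x * f (pt v) := by
  conv_lhs => rw [← hβ.sum_smul x]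
  exact affineMap_sum_smul f S _ _ (hβ.sum_eq_one x)

lemma apply_sum (hβ : IsBarycentric S β) {R : Finset (CubeVertex n)} (hR : R ⊆ S)
    {w : CubeVertex n → ℝ} (hw : ∑ v ∈ R, w v = 1) {u : CubeVertex n} (hu : u ∈ S) :
    β u (∑ v ∈ R, w v • pt v) = if u ∈ R then w u else 0 := by
  classical
  rw [affineMap_sum_smul _ _ _ _ hw]
  split_ifs with h
  · rw [sum_eq_single_of_mem u h, hβ.self u hu, mul_one]
    intro v hv hvu
    rw [hβ.ne u hu v (hR hv) hvu.symm, mul_zero]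
  · refine sum_eq_zero fun v hv => ?_
    rw [hβ.ne u hu v (hR hv) (fun e => h (e ▸ hv)), mul_zero]

lemma nonneg (hβ : IsBarycentric S β) {x : EuclideanSpace ℝ (Fin n)} (hx : x ∈ hull S)
    {u : CubeVertex n} (hu : u ∈ S) : 0 ≤ β u x := by
  obtain ⟨w, h0, h1, rfl⟩ := mem_hull_iff.1 hx
  rw [hβ.apply_sum subset_rfl h1 hu, if_pos hu]
  exact h0 u hu

lemma mem_hull (hβ : IsBarycentric S β) {x : EuclideanSpace ℝ (Fin n)}
    (hx : ∀ u ∈ S, 0 ≤ β u x) : x ∈ hull S :=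
  mem_hull_iff.2 ⟨fun v => β v x, hx, hβ.sum_eq_one x, hβ.sum_smul x⟩

lemma eq_zero_of_mem_hull (hβ : IsBarycentric S β) {R : Finset (CubeVertex n)} (hR : R ⊆ S)
    {x : EuclideanSpace ℝ (Fin n)} (hx : x ∈ hull R) {u : CubeVertex n} (hu : u ∈ S)
    (huR : u ∉ R) : β u x = 0 := by
  obtain ⟨w, h0, h1, rfl⟩ := mem_hull_iff.1 hx
  rw [hβ.apply_sum hR h1 hu, if_neg huR]

end IsBarycentric

/-! ### Barycenters and neighbours across facets -/

/-- The barycenter of a set of cube vertices. -/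
def bary (R : Finset (CubeVertex n)) : EuclideanSpace ℝ (Fin n) :=
  ∑ v ∈ R, (R.card : ℝ)⁻¹ • pt v

lemma sum_card_inv {R : Finset (CubeVertex n)} (hR : R.Nonempty) :
    ∑ _v ∈ R, (R.card : ℝ)⁻¹ = 1 := by
  have : (R.card : ℝ) ≠ 0 := by exact_mod_cast hR.card_pos.ne'
  simp [this]

lemma bary_mem_hull {R : Finset (CubeVertex n)} (hR : R.Nonempty) : bary R ∈ hull R :=
  mem_hull_iff.2 ⟨fun _ => (R.card : ℝ)⁻¹, fun _ _ => by positivity, sum_card_inv hR, rfl⟩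

lemma IsBarycentric.apply_bary {S R : Finset (CubeVertex n)}
    {β : CubeVertex n → EuclideanSpace ℝ (Fin n) →ᵃ[ℝ] ℝ} (hβ : IsBarycentric S β) (hR : R ⊆ S)
    (hne : R.Nonempty) {u : CubeVertex n} (hu : u ∈ S) :
    β u (bary R) = if u ∈ R then (R.card : ℝ)⁻¹ else 0 :=
  hβ.apply_sum hR (sum_card_inv hne) hu

/-- A face whose barycenter lies in another face of the same simplex is contained in it. -/
lemma IsBarycentric.subset_of_bary_mem {S R R' : Finset (CubeVertex n)}
    {β : CubeVertex n → EuclideanSpace ℝ (Fin n) →ᵃ[ℝ] ℝ} (hβ : IsBarycentric S β) (hR : R ⊆ S)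
    (hne : R.Nonempty) (hR' : R' ⊆ S) (h : bary R ∈ hull R') : R ⊆ R' := by
  intro u hu
  by_contra hu'
  have h1 := hβ.eq_zero_of_mem_hull hR' h (hR hu) hu'
  rw [hβ.apply_bary hR hne (hR hu), if_pos hu] at h1
  have : (R.card : ℝ) ≠ 0 := by exact_mod_cast hne.card_pos.ne'
  exact inv_ne_zero this h1

/-- The set `F` of vertices lies in a facet of the cube. -/
def InCubeFacet (F : Finset (CubeVertex n)) : Prop := ∃ i b, ∀ u ∈ F, u i = b

lemma bary_apply (R : Finset (CubeVertex n)) (i : Fin n) :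
    bary R i = ∑ v ∈ R, (R.card : ℝ)⁻¹ * pt v i := by
  simp [bary]

lemma bary_mem_interior {F : Finset (CubeVertex n)} (hne : F.Nonempty) (hF : ¬ InCubeFacet F)
    (i : Fin n) : 0 < bary F i ∧ bary F i < 1 := by
  have hc : 0 < (F.card : ℝ)⁻¹ := by
    have : 0 < (F.card : ℝ) := by exact_mod_cast hne.card_pos
    positivity
  simp only [InCubeFacet, not_exists, not_forall] at hF
  have hpt : ∀ v : CubeVertex n, 0 ≤ pt v i ∧ pt v i ≤ 1 := fun v => by
    rw [pt_apply]; split <;> norm_num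
  rw [bary_apply]
  constructor
  · obtain ⟨u, hu, hui⟩ := hF i false
    refine sum_pos' (fun v _ => mul_nonneg hc.le (hpt v).1) ⟨u, hu, ?_⟩
    rw [pt_apply, if_pos (by simpa using hui)]; linarith
  · obtain ⟨u, hu, hui⟩ := hF i true
    rw [← sum_card_inv hne]
    refine sum_lt_sum (fun v _ => ?_) ⟨u, hu, ?_⟩
    · exact mul_le_of_le_one_right hc.le (hpt v).2
    · rw [pt_apply, if_neg hui]; linarith

lemma IsBinarySimplex.eq_of_subset {S S' : Finset (CubeVertex n)} (hS : IsBinarySimplex S)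
    (hS' : IsBinarySimplex S') (h : S ⊆ S') : S = S' :=
  eq_of_subset_of_card_le h (by rw [hS.1, hS'.1])

lemma IsBinarySimplex.nonempty {S : Finset (CubeVertex n)} (hS : IsBinarySimplex S) :
    S.Nonempty := card_pos.1 (by rw [hS.1]; omega)

/-- A subset of a triangulation that covers the cube is the whole triangulation. -/
lemma IsBinaryTriangulation.eq_of_subset_of_cover {T T' : Finset (Finset (CubeVertex n))}
    (hT : IsBinaryTriangulation T) (hsub : T' ⊆ T) (hcov : cube n ⊆ ⋃ S ∈ T', hull S) :
    T' = T := by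
  refine hsub.antisymm fun S hS => ?_
  have hSs := hT.simplex S hS
  obtain ⟨β, hβ⟩ := hSs.exists_isBarycentric
  have hmem := bary_mem_hull hSs.nonempty
  -- The barycenter has all coordinates positive in `S`, so a face of `S` containing it is all of
  -- `S`; hence `S ⊆ S'`.
  obtain ⟨S', hS', hx⟩ := Set.mem_iUnion₂.1 (hcov (hull_subset_cube S hmem))
  have hx' : bary S ∈ hull (S ∩ S') := by
    rw [← hT.face_to_face S hS S' (hsub hS')]; exact ⟨hmem, hx⟩
  have h := hβ.subset_of_bary_mem subset_rfl hSs.nonempty inter_subset_left hx'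
  rwa [hSs.eq_of_subset (hT.simplex S' (hsub hS')) (h.trans inter_subset_right)]

lemma IsBinaryTriangulation.nonempty {T : Finset (Finset (CubeVertex n))}
    (hT : IsBinaryTriangulation T) : T.Nonempty := by
  have h : (pt (origin n)) ∈ cube n := fun i => by simp [pt_apply, origin]
  rw [← hT.cover] at h
  obtain ⟨S, hS, -⟩ := Set.mem_iUnion₂.1 h
  exact ⟨S, hS⟩

/-- Every facet of a simplex of a triangulation that does not lie in the boundary of the cube is
shared with another simplex. -/
lemma IsBinaryTriangulation.exists_neighbor {T : Finset (Finset (CubeVertex n))} (hn : n ≠ 0)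
    (hT : IsBinaryTriangulation T) {S : Finset (CubeVertex n)} (hS : S ∈ T) {v : CubeVertex n}
    (hv : v ∈ S) (hF : ¬ InCubeFacet (S.erase v)) :
    ∃ w, w ∉ S ∧ insert w (S.erase v) ∈ T := by
  have hSs := hT.simplex S hS
  have hne : (S.erase v).Nonempty := by
    rw [← card_pos, card_erase_of_mem hv, hSs.1]; omega
  obtain ⟨β, hβ⟩ := hSs.exists_isBarycentric
  set p := bary (S.erase v) with hp
  -- The ray from the barycenter of the facet pointing away from `v`. It leaves `S` at once, since
  -- `β v` equals `-t` along it, but stays in the cube for small `t` because the facet is not in the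
  -- boundary.
  set γ : ℝ → EuclideanSpace ℝ (Fin n) := fun t => p + t • (p - pt v) with hγ
  have hγc : Continuous γ := by fun_prop
  have hγ0 : γ 0 = p := by simp [hγ]
  have hβv : ∀ t, β v (γ t) = -t := by
    intro t
    have h1 : γ t = AffineMap.lineMap p (pt v) (-t) := by
      simp only [hγ, AffineMap.lineMap_apply_module']; module
    rw [h1, AffineMap.apply_lineMap, AffineMap.lineMap_apply_module', hβ.self v hv,
      hp, hβ.apply_bary (erase_subset _ _) hne hv]
    simp
  have hcube : ∀ᶠ t in nhdsWithin (0 : ℝ) (Set.Ioi 0), γ t ∈ cube n := by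
    refine Filter.Eventually.filter_mono nhdsWithin_le_nhds ?_
    have : ∀ i, ∀ᶠ t in nhds (0 : ℝ), 0 ≤ γ t i ∧ γ t i ≤ 1 := by
      intro i
      have hi : Filter.Tendsto (fun t => γ t i) (nhds 0) (nhds (p i)) := by
        rw [← hγ0]
        exact (Continuous.tendsto (by fun_prop) 0)
      have h := bary_mem_interior hne hF i
      filter_upwards [hi.eventually (lt_mem_nhds h.1), hi.eventually (gt_mem_nhds h.2)]
        with t h1 h2 using ⟨h1.le, h2.le⟩
    exact Filter.eventually_all.2 this
  have hclosed : IsClosed (⋃ R ∈ T.erase S, hull R) :=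
    (T.erase S).finite_toSet.isClosed_biUnion fun R _ => (isCompact_hull R).isClosed
  -- For small `t > 0` the ray lies in the other simplices, whose union is closed, so the limit
  -- point `p` does too.
  have hmem : p ∈ ⋃ R ∈ T.erase S, hull R := by
    rw [← hγ0]
    refine hclosed.mem_of_tendsto ((hγc.tendsto 0).mono_left nhdsWithin_le_nhds)
      (b := nhdsWithin (0 : ℝ) (Set.Ioi 0)) ?_
    filter_upwards [hcube, self_mem_nhdsWithin] with t ht ht0
    rw [← hT.cover] at ht
    obtain ⟨R, hR, hx⟩ := Set.mem_iUnion₂.1 ht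
    refine Set.mem_iUnion₂.2 ⟨R, mem_erase.2 ⟨?_, hR⟩, hx⟩
    rintro rfl
    have := hβ.nonneg hx hv
    rw [hβv] at this
    have ht0' : (0 : ℝ) < t := ht0
    linarith
  obtain ⟨R, hR, hx⟩ := Set.mem_iUnion₂.1 hmem
  obtain ⟨hRS, hR⟩ := mem_erase.1 hR
  have hxS : p ∈ hull S :=
    convexHull_mono (Set.image_mono (by simp)) (bary_mem_hull hne)
  have hx' : p ∈ hull (S ∩ R) := by
    rw [← hT.face_to_face S hS R hR]; exact ⟨hxS, hx⟩
  have hsub : S.erase v ⊆ R :=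
    (hβ.subset_of_bary_mem (erase_subset _ _) hne inter_subset_left hx').trans inter_subset_right
  have hRs := hT.simplex R hR
  obtain ⟨w, hw, hwR⟩ := exists_eq_insert_iff.2
    ⟨hsub, by rw [card_erase_of_mem hv, hSs.1, hRs.1]; omega⟩
  refine ⟨w, fun hwS => hRS ?_, hwR ▸ hR⟩
  have : w = v := by
    by_contra h
    exact hw (mem_erase.2 ⟨h, hwS⟩)
  rw [← hwR, this, insert_erase hv]

/-! ### Lifted families of simplices -/

/-- `h` is the height function of a lifting whose lower hull has the simplices of `T` among its
facets. -/
def IsLift (T : Finset (Finset (CubeVertex n))) (h : CubeVertex n → ℝ) : Prop :=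
  ∀ S ∈ T, ∃ l : EuclideanSpace ℝ (Fin n) →ᵃ[ℝ] ℝ,
    (∀ v ∈ S, l (pt v) = h v) ∧ ∀ v, v ∉ S → l (pt v) < h v

/-- For `x` in both hulls, `l x` is an average of heights over `S`, hence at least `m x`; by
symmetry the two agree. The weighted gaps `h - m` over `S` then sum to zero, and since `m < h` off
`S'`, all weights off `S'` vanish. -/
lemma IsLift.face_to_face {T : Finset (Finset (CubeVertex n))} {h : CubeVertex n → ℝ}
    (hT : IsLift T h) {S S' : Finset (CubeVertex n)} (hS : S ∈ T) (hS' : S' ∈ T) :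
    hull S ∩ hull S' = hull (S ∩ S') := by
  refine Set.Subset.antisymm ?_ (Set.subset_inter
    (convexHull_mono (Set.image_mono (by simp))) (convexHull_mono (Set.image_mono (by simp))))
  rintro x ⟨hx, hx'⟩
  obtain ⟨l, hl, hl'⟩ := hT S hS
  obtain ⟨m, hm, hm'⟩ := hT S' hS'
  have key : ∀ (R : Finset (CubeVertex n)) (f : EuclideanSpace ℝ (Fin n) →ᵃ[ℝ] ℝ)
      (w : CubeVertex n → ℝ), (∀ v ∈ R, 0 ≤ w v) → ∑ v ∈ R, w v = 1 →
      ∑ v ∈ R, w v • pt v = x → (∀ v, f (pt v) ≤ h v) → f x ≤ ∑ v ∈ R, w v * h v := by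
    intro R f w h0 h1 hx hf
    rw [← hx, affineMap_sum_smul f R w _ h1]
    exact sum_le_sum fun v hv => mul_le_mul_of_nonneg_left (hf v) (h0 v hv)
  have hle : ∀ v, l (pt v) ≤ h v := fun v => by
    by_cases hv : v ∈ S
    · exact (hl v hv).le
    · exact (hl' v hv).le
  have hme : ∀ v, m (pt v) ≤ h v := fun v => by
    by_cases hv : v ∈ S'
    · exact (hm v hv).le
    · exact (hm' v hv).le
  obtain ⟨w, hw0, hw1, hwx⟩ := mem_hull_iff.1 hx
  obtain ⟨u, hu0, hu1, hux⟩ := mem_hull_iff.1 hx'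
  have e1 : l x = ∑ v ∈ S, w v * h v := by
    rw [← hwx, affineMap_sum_smul l S w _ hw1]
    exact sum_congr rfl fun v hv => by rw [hl v hv]
  have e2 : m x = ∑ v ∈ S', u v * h v := by
    rw [← hux, affineMap_sum_smul m S' u _ hu1]
    exact sum_congr rfl fun v hv => by rw [hm v hv]
  have i1 := key S m w hw0 hw1 hwx hme
  have e3 : m x = ∑ v ∈ S, w v * m (pt v) := by
    conv_lhs => rw [← hwx]
    exact affineMap_sum_smul m S w _ hw1
  have i2 := key S' l u hu0 hu1 hux hle
  have hzero : ∑ v ∈ S, w v * (h v - m (pt v)) = 0 := by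
    simp only [mul_sub, sum_sub_distrib]; linarith
  rw [sum_eq_zero_iff_of_nonneg fun v hv =>
    mul_nonneg (hw0 v hv) (sub_nonneg.2 (hme v))] at hzero
  have hwz : ∀ v ∈ S, v ∉ S ∩ S' → w v = 0 := by
    intro v hv hv'
    have hvS' : v ∉ S' := fun h => hv' (mem_inter.2 ⟨hv, h⟩)
    exact (mul_eq_zero.1 (hzero v hv)).resolve_right (sub_pos.2 (hm' v hvS')).ne'
  refine mem_hull_iff.2 ⟨w, fun v hv => hw0 v (mem_inter.1 hv).1, ?_, ?_⟩
  · rw [← hw1]; exact sum_subset inter_subset_left hwz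
  · rw [← hwx]
    exact sum_subset inter_subset_left fun v hv hv' => by rw [hwz v hv hv', zero_smul]

/-- A nonempty set of simplices in the lower hull of a lifting that is closed under passing
through interior facets covers the cube. -/
lemma IsLift.cover {T : Finset (Finset (CubeVertex n))} {h : CubeVertex n → ℝ}
    (hT : IsLift T h) (hne : T.Nonempty) (hs : ∀ S ∈ T, IsBinarySimplex S)
    (hnb : ∀ S ∈ T, ∀ v ∈ S, ¬ InCubeFacet (S.erase v) →
      ∃ w, w ∉ S ∧ insert w (S.erase v) ∈ T) :
    cube n ⊆ ⋃ S ∈ T, hull S := by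
  intro x hx
  choose! l hl hl' using hT
  -- If `x` were beyond the facet opposite `v`, then either that facet is in the boundary and `x` is
  -- outside the cube, or the neighbour across it has a larger affine function at `x`.
  obtain ⟨S, hS, hmax⟩ := T.exists_max_image (fun S => l S x) hne
  refine Set.mem_iUnion₂.2 ⟨S, hS, ?_⟩
  obtain ⟨β, hβ⟩ := (hs S hS).exists_isBarycentric
  refine hβ.mem_hull fun v hv => ?_
  by_contra! hlt
  by_cases hF : InCubeFacet (S.erase v)
  · obtain ⟨i, b, hb⟩ := hF
    let f : EuclideanSpace ℝ (Fin n) →ᵃ[ℝ] ℝ :=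
      (EuclideanSpace.proj i : EuclideanSpace ℝ (Fin n) →L[ℝ] ℝ).toLinearMap.toAffineMap
    have hf : ∀ y, f y = y i := fun y => rfl
    have hβi : ∀ y, β v y * (pt v i - (if b then 1 else 0)) = y i - (if b then 1 else 0) := by
      intro y
      have h1 := hβ.affine_apply f y
      simp only [hf] at h1
      have h2 : ∑ u ∈ S, β u y * (pt u i - (if b then 1 else 0)) =
          β v y * (pt v i - (if b then 1 else 0)) := by
        refine sum_eq_single_of_mem v hv fun u hu huv => ?_
        rw [pt_apply, hb u (mem_erase.2 ⟨huv, hu⟩), sub_self, mul_zero]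
      rw [← h2]
      simp only [mul_sub, sum_sub_distrib, ← sum_mul, hβ.sum_eq_one, ← h1, one_mul]
    -- Otherwise all of `S` would lie in one cube facet, making coordinate `i` constant on the whole
    -- space; a point of the opposite facet refutes this.
    have hvi : pt v i = if b then 0 else 1 := by
      by_contra hne'
      have hvb : pt v i - (if b then 1 else 0) = 0 := by
        rw [pt_apply] at hne' ⊢
        cases hvi : v i <;> cases b <;> simp_all
      have h1 := hβi (pt (fun j => !b))
      rw [hvb, mul_zero, pt_apply] at h1
      cases b <;> simp at h1
    have hxi := hx i
    have hsum := hβi x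
    rw [hvi] at hsum
    cases b <;> simp at hsum <;> nlinarith
  · obtain ⟨w, hw, hS'⟩ := hnb S hS v hv hF
    set S' := insert w (S.erase v) with hS'def
    have hvS' : v ∉ S' := by
      simp only [hS'def, mem_insert, mem_erase, not_or, ne_eq, not_true_eq_false, false_and,
        not_false_eq_true, and_true]
      rintro rfl; exact hw hv
    -- The difference vanishes on the common facet and is negative at `v`, so it is positive
    -- wherever `β v` is negative.
    have h1 := hβ.affine_apply (l S' - l S) x
    rw [sum_eq_single_of_mem v hv] at h1
    · have h2 := hl' S' hS' v hvS'
      have h3 := hl S hS v hv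
      have h4 := hmax S' hS'
      simp only [AffineMap.coe_sub, Pi.sub_apply] at h1
      nlinarith
    · intro u hu huv
      have huS' : u ∈ S' := mem_insert_of_mem (mem_erase.2 ⟨huv, hu⟩)
      simp [hl S hS u hu, hl S' hS' u huS']

lemma IsLift.mono {T T' : Finset (Finset (CubeVertex n))} {h : CubeVertex n → ℝ}
    (hT : IsLift T h) (hsub : T' ⊆ T) : IsLift T' h :=
  fun S hS => hT S (hsub hS)

/-! ### Outward normals and dihedral angles -/

/-- Outward normals of a facet are unique up to a positive factor. -/
lemma IsOutwardNormal.exists_smul {S : Finset (CubeVertex n)} (hn : n ≠ 0)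
    (hS : IsBinarySimplex S) {v : CubeVertex n} (hv : v ∈ S) {q r : EuclideanSpace ℝ (Fin n)}
    (hq : IsOutwardNormal S v q) (hr : IsOutwardNormal S v r) : ∃ t : ℝ, 0 < t ∧ q = t • r := by
  obtain ⟨β, hβ⟩ := hS.exists_isBarycentric
  obtain ⟨a, ha⟩ : (S.erase v).Nonempty := by
    rw [← card_pos, card_erase_of_mem hv, hS.1]; omega
  obtain ⟨hav, ha⟩ := mem_erase.1 ha
  -- Pairing with a normal gives an affine function vanishing on the facet, hence a multiple of `β
  -- v`.
  have key : ∀ q, IsOutwardNormal S v q → ∀ x,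
      inner ℝ q (x - pt a) = β v x * inner ℝ q (pt v - pt a) := by
    intro q hq x
    let f : EuclideanSpace ℝ (Fin n) →ᵃ[ℝ] ℝ :=
      (innerSL ℝ q).toLinearMap.toAffineMap - AffineMap.const ℝ _ (inner ℝ q (pt a))
    have hf : ∀ y, f y = inner ℝ q (y - pt a) := fun y => by
      simp [f, inner_sub_right]
    rw [← hf, ← hf, hβ.affine_apply f x]
    refine sum_eq_single_of_mem v hv fun u hu huv => ?_
    rw [hf, hq.1 u hu a ha huv hav, mul_zero]
  have hqa := hq.2 a ha hav
  have hra := hr.2 a ha hav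
  refine ⟨inner ℝ q (pt v - pt a) / inner ℝ r (pt v - pt a), div_pos_of_neg_of_neg hqa hra, ?_⟩
  refine ext_inner_right ℝ fun y => ?_
  have h1 := key q hq (y + pt a)
  have h2 := key r hr (y + pt a)
  rw [add_sub_cancel_right] at h1 h2
  rw [real_inner_smul_left, h1, h2]
  field_simp [hra.ne]

lemma nonobtuse_angle_iff (q r : EuclideanSpace ℝ (Fin n)) :
    Real.pi - InnerProductGeometry.angle q r ≤ Real.pi / 2 ↔ inner ℝ q r ≤ 0 := by
  have h : Real.pi - InnerProductGeometry.angle q r ≤ Real.pi / 2 ↔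
      ¬ InnerProductGeometry.angle q r < Real.pi / 2 := by
    rw [not_lt]
    constructor <;> intro h <;> linarith
  rw [h, InnerProductGeometry.angle, Real.arccos_lt_pi_div_two, not_lt]
  by_cases hqr : ‖q‖ * ‖r‖ = 0
  · have : inner ℝ q r = 0 := by
      rcases mul_eq_zero.1 hqr with h | h
      · rw [norm_eq_zero.1 h, inner_zero_left]
      · rw [norm_eq_zero.1 h, inner_zero_right]
    simp [this]
  · have : 0 < ‖q‖ * ‖r‖ := lt_of_le_of_ne (by positivity) (Ne.symm hqr)
    rw [div_le_iff₀ this, zero_mul]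

/-! ### Invariance under the symmetries of the cube -/

/-- The linear part of a symmetry of the cube. -/
def symmetryLinear (σ : Equiv.Perm (Fin n)) (b : Fin n → Bool) :
    EuclideanSpace ℝ (Fin n) ≃ₗᵢ[ℝ] EuclideanSpace ℝ (Fin n) :=
  -- The inverse appears because `piLpCongrLeft` reindexes by the inverse of its argument.
  (LinearIsometryEquiv.piLpCongrLeft 2 ℝ ℝ σ.symm).trans
    (LinearIsometryEquiv.piLpCongrRight 2 fun i =>
      if b i then LinearIsometryEquiv.neg ℝ else LinearIsometryEquiv.refl ℝ ℝ)

lemma symmetryLinear_apply (σ : Equiv.Perm (Fin n)) (b : Fin n → Bool)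
    (x : EuclideanSpace ℝ (Fin n)) (i : Fin n) :
    symmetryLinear σ b x i = if b i then -x (σ i) else x (σ i) := by
  cases h : b i <;> simp [symmetryLinear, h, Equiv.piCongrLeft']

/-- A symmetry of the cube as an affine automorphism of Euclidean space. -/
def symmetryAffine (σ : Equiv.Perm (Fin n)) (b : Fin n → Bool) :
    EuclideanSpace ℝ (Fin n) ≃ᵃ[ℝ] EuclideanSpace ℝ (Fin n) :=
  (symmetryLinear σ b).toLinearEquiv.toAffineEquiv.trans (AffineEquiv.constVAdd ℝ _ (pt b))

lemma symmetryAffine_apply (σ : Equiv.Perm (Fin n)) (b : Fin n → Bool)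
    (x : EuclideanSpace ℝ (Fin n)) :
    symmetryAffine σ b x = pt b + symmetryLinear σ b x := rfl

lemma symmetryAffine_apply_apply (σ : Equiv.Perm (Fin n)) (b : Fin n → Bool)
    (x : EuclideanSpace ℝ (Fin n)) (i : Fin n) :
    symmetryAffine σ b x i = if b i then 1 - x (σ i) else x (σ i) := by
  rw [symmetryAffine_apply, PiLp.add_apply, symmetryLinear_apply, pt_apply]
  split <;> ring

lemma symmetryAffine_pt (σ : Equiv.Perm (Fin n)) (b : Fin n → Bool) (v : CubeVertex n) :
    symmetryAffine σ b (pt v) = pt (cubeSymmetry σ b v) := by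
  ext i
  rw [symmetryAffine_apply_apply, pt_apply, pt_apply, cubeSymmetry]
  cases b i <;> cases v (σ i) <;> simp

lemma cubeSymmetry_injective (σ : Equiv.Perm (Fin n)) (b : Fin n → Bool) :
    Function.Injective (cubeSymmetry σ b) := by
  intro u v h
  refine pt_injective ((symmetryAffine σ b).injective ?_)
  rw [symmetryAffine_pt, symmetryAffine_pt, h]

lemma pt_cubeSymmetry_sub (σ : Equiv.Perm (Fin n)) (b : Fin n → Bool) (u v : CubeVertex n) :
    pt (cubeSymmetry σ b u) - pt (cubeSymmetry σ b v) = symmetryLinear σ b (pt u - pt v) := by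
  rw [← symmetryAffine_pt, ← symmetryAffine_pt, symmetryAffine_apply, symmetryAffine_apply,
    map_sub, add_sub_add_left_eq_sub]

lemma hull_image_cubeSymmetry (σ : Equiv.Perm (Fin n)) (b : Fin n → Bool)
    (S : Finset (CubeVertex n)) :
    hull (S.image (cubeSymmetry σ b)) = symmetryAffine σ b '' hull S := by
  have h := (symmetryAffine σ b).toAffineMap.image_convexHull (pt '' (S : Set (CubeVertex n)))
  rw [AffineEquiv.coe_toAffineMap] at h
  rw [hull, hull, h, coe_image, Set.image_image, Set.image_image]
  simp only [symmetryAffine_pt]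

lemma symmetryAffine_image_cube (σ : Equiv.Perm (Fin n)) (b : Fin n → Bool) :
    symmetryAffine σ b '' cube n = cube n := by
  have key : ∀ x, symmetryAffine σ b x ∈ cube n ↔ x ∈ cube n := by
    intro x
    simp only [cube, Set.mem_ofPred_eq, symmetryAffine_apply_apply]
    have h1 : ∀ i, (0 ≤ (if b i then 1 - x (σ i) else x (σ i)) ∧
        (if b i then 1 - x (σ i) else x (σ i)) ≤ 1) ↔ 0 ≤ x (σ i) ∧ x (σ i) ≤ 1 := by
      intro i
      split
      · constructor <;> rintro ⟨h1, h2⟩ <;> constructor <;> linarith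
      · rfl
    simp only [h1]
    exact ⟨fun h i => by simpa using h (σ.symm i), fun h i => h (σ i)⟩
  ext x
  constructor
  · rintro ⟨y, hy, rfl⟩
    exact (key y).2 hy
  · intro hx
    refine ⟨(symmetryAffine σ b).symm x, ?_, by simp⟩
    rw [← key]
    simpa using hx

lemma IsBinarySimplex.image_cubeSymmetry {S : Finset (CubeVertex n)} (hS : IsBinarySimplex S)
    (σ : Equiv.Perm (Fin n)) (b : Fin n → Bool) :
    IsBinarySimplex (S.image (cubeSymmetry σ b)) := by
  refine ⟨by rw [card_image_of_injective _ (cubeSymmetry_injective σ b), hS.1], ?_⟩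
  have h1 := hS.2.map' (symmetryAffine σ b).toAffineMap (symmetryAffine σ b).injective
  let e : S ≃ S.image (cubeSymmetry σ b) :=
    Equiv.ofBijective (fun v => ⟨cubeSymmetry σ b v, mem_image_of_mem _ v.2⟩) (by
      constructor
      · intro u v h
        exact Subtype.ext (cubeSymmetry_injective σ b (congrArg Subtype.val h))
      · rintro ⟨w, hw⟩
        obtain ⟨v, hv, rfl⟩ := mem_image.1 hw
        exact ⟨⟨v, hv⟩, rfl⟩)
  rw [← affineIndependent_equiv e]
  convert h1 using 1
  funext v
  exact (symmetryAffine_pt σ b v).symm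

/-- Normals are pulled back rather than pushed forward because `IsNonobtuse` of the image quantifies
over all normals of the image. -/
lemma IsOutwardNormal.of_cubeSymmetry {σ : Equiv.Perm (Fin n)} {b : Fin n → Bool}
    {S : Finset (CubeVertex n)} {v : CubeVertex n} {q : EuclideanSpace ℝ (Fin n)}
    (h : IsOutwardNormal (S.image (cubeSymmetry σ b)) (cubeSymmetry σ b v) q) :
    IsOutwardNormal S v ((symmetryLinear σ b).symm q) := by
  have hinner : ∀ x y : CubeVertex n, inner ℝ ((symmetryLinear σ b).symm q) (pt x - pt y) =
      inner ℝ q (pt (cubeSymmetry σ b x) - pt (cubeSymmetry σ b y)) := by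
    intro x y
    rw [pt_cubeSymmetry_sub, ← (symmetryLinear σ b).inner_map_map,
      LinearIsometryEquiv.apply_symm_apply]
  have hinj := cubeSymmetry_injective σ b
  refine ⟨fun x hx y hy hxv hyv => ?_, fun x hx hxv => ?_⟩
  · rw [hinner]
    exact h.1 _ (mem_image_of_mem _ hx) _ (mem_image_of_mem _ hy) (hinj.ne hxv) (hinj.ne hyv)
  · rw [hinner]
    exact h.2 _ (mem_image_of_mem _ hx) (hinj.ne hxv)

lemma IsNonobtuse.image_cubeSymmetry {S : Finset (CubeVertex n)} (hS : IsNonobtuse S)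
    (σ : Equiv.Perm (Fin n)) (b : Fin n → Bool) :
    IsNonobtuse (S.image (cubeSymmetry σ b)) := by
  intro v' hv' w' hw' hvw q r hq hr
  obtain ⟨v, hv, rfl⟩ := mem_image.1 hv'
  obtain ⟨w, hw, rfl⟩ := mem_image.1 hw'
  have h := hS v hv w hw (fun h => hvw (h ▸ rfl)) _ _ hq.of_cubeSymmetry hr.of_cubeSymmetry
  rwa [← LinearIsometryEquiv.coe_toLinearIsometry, LinearIsometry.angle_map] at h

lemma IsNonobtuseBinaryTriangulation.image_cubeSymmetry {T : Finset (Finset (CubeVertex n))}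
    (hT : IsNonobtuseBinaryTriangulation T) (σ : Equiv.Perm (Fin n)) (b : Fin n → Bool) :
    IsNonobtuseBinaryTriangulation (T.image fun S => S.image (cubeSymmetry σ b)) := by
  refine ⟨⟨?_, ?_, ?_⟩, ?_⟩
  · intro S' hS'
    obtain ⟨S, hS, rfl⟩ := mem_image.1 hS'
    exact (hT.1.simplex S hS).image_cubeSymmetry σ b
  · rw [← symmetryAffine_image_cube σ b, ← hT.1.cover, Set.image_iUnion₂, set_biUnion_finset_image]
    simp only [hull_image_cubeSymmetry]
  · intro R' hR' S' hS'
    obtain ⟨R, hR, rfl⟩ := mem_image.1 hR'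
    obtain ⟨S, hS, rfl⟩ := mem_image.1 hS'
    rw [← image_inter _ _ (cubeSymmetry_injective σ b), hull_image_cubeSymmetry,
      hull_image_cubeSymmetry, hull_image_cubeSymmetry, ← hT.1.face_to_face R hR S hS,
      Set.image_inter (symmetryAffine σ b).injective]
  · intro S' hS'
    obtain ⟨S, hS, rfl⟩ := mem_image.1 hS'
    exact (hT.2 S hS).image_cubeSymmetry σ b

lemma cubeSymmetry_one_involutive (b : Fin n → Bool) :
    Function.Involutive (cubeSymmetry 1 b) := by
  intro v
  funext i
  simp [cubeSymmetry]

/-! ### Integer codes, the two tables and the finite checks -/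

/-- The vertex of the 4-cube whose `i`-th coordinate is the `i`-th binary digit of `k`. -/
def decV (k : ℕ) : CubeVertex 4 := fun i => k.testBit i

/-- The set of vertices with codes in `L`. -/
def decS (L : List ℕ) : Finset (CubeVertex 4) := (L.map decV).toFinset

/-- The code of a vertex. -/
def enc (v : CubeVertex 4) : ℕ := ∑ i, if v i then 2 ^ (i : ℕ) else 0

/-- The bit mask of a list of codes, for comparing lists as sets. -/
def mask : List ℕ → ℕ
  | [] => 0
  | k :: L => 2 ^ k ||| mask L

/-- Integer vectors in dimension four. -/
@[ext] structure IVec where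
  x : ℤ
  y : ℤ
  z : ℤ
  w : ℤ
  deriving DecidableEq

namespace IVec

def sub (p q : IVec) : IVec := ⟨p.x - q.x, p.y - q.y, p.z - q.z, p.w - q.w⟩

def dot (p q : IVec) : ℤ := p.x * q.x + p.y * q.y + p.z * q.z + p.w * q.w

def det3 (a b c d e f g h i : ℤ) : ℤ :=
  a * (e * i - f * h) - b * (d * i - f * g) + c * (d * h - e * g)

/-- The cross product of three vectors in dimension four. -/
def cross (p q r : IVec) : IVec :=
  ⟨det3 p.y p.z p.w q.y q.z q.w r.y r.z r.w, -det3 p.x p.z p.w q.x q.z q.w r.x r.z r.w,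
    det3 p.x p.y p.w q.x q.y q.w r.x r.y r.w, -det3 p.x p.y p.z q.x q.y q.z r.x r.y r.z⟩

def ofCode (k : ℕ) : IVec :=
  ⟨if k.testBit 0 then 1 else 0, if k.testBit 1 then 1 else 0,
    if k.testBit 2 then 1 else 0, if k.testBit 3 then 1 else 0⟩

end IVec

/-- A normal vector of the facet with the given vertex codes. -/
def facetNormal (w p q r : ℕ) : IVec :=
  IVec.cross ((IVec.ofCode p).sub (.ofCode w)) ((IVec.ofCode q).sub (.ofCode w))
    ((IVec.ofCode r).sub (.ofCode w))

/-- The signed volume (times `4!`) of the simplex with the given vertex codes. -/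
def volume (v w p q r : ℕ) : ℤ :=
  (facetNormal w p q r).dot ((IVec.ofCode v).sub (.ofCode w))

/-- The dihedral angle between the facets opposite `v` and `w` is not obtuse. -/
def DihedralOK (v w p q r : ℕ) : Prop :=
  volume v w p q r * volume w v p q r * (facetNormal w p q r).dot (facetNormal v p q r) ≤ 0

/-- Either the simplex is nondegenerate or the facet opposite `v` is degenerate. -/
def VolumeOK (v w p q r : ℕ) : Prop :=
  volume v w p q r ≠ 0 ∨ facetNormal w p q r = ⟨0, 0, 0, 0⟩

instance (v w p q r : ℕ) : Decidable (DihedralOK v w p q r) := by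
  unfold DihedralOK; infer_instance

instance (v w p q r : ℕ) : Decidable (VolumeOK v w p q r) := by
  unfold VolumeOK; infer_instance

/-- A necessary condition on a pair of vertices of a nonobtuse simplex. -/
def weakPair (v w : ℕ) : List ℕ → Bool
  | [p, q, r] => decide (VolumeOK v w p q r) && decide (DihedralOK v w p q r)
  | _ => false

/-- A sufficient condition on pairs of vertices for a simplex to be nonobtuse. -/
def strictPair (v w : ℕ) : List ℕ → Bool
  | [p, q, r] => decide (volume v w p q r ≠ 0) && decide (DihedralOK v w p q r)
  | _ => false

def weakCheck (L : List ℕ) : Bool :=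
  L.all fun v => L.all fun w => v == w || weakPair v w ((L.erase v).erase w)

def strictCheck (L : List ℕ) : Bool :=
  L.all fun v => L.all fun w => v == w || strictPair v w ((L.erase v).erase w)

def interiorCheck (F : List ℕ) : Bool :=
  (List.range 4).all fun i => F.any (fun u => u.testBit i) && F.any (fun u => !u.testBit i)

def affineEval (c : ℤ) (l : IVec) (k : ℕ) : ℤ := c + l.dot (.ofCode k)

/-- The path simplices, with the affine functions interpolating `standardHeight`. -/
def standardRows : List (List ℕ × ℤ × IVec) :=
  [([0, 1, 3, 7, 15], 0, ⟨-1, -3, -5, -7⟩),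
   ([0, 1, 3, 11, 15], 0, ⟨-1, -3, -7, -5⟩),
   ([0, 1, 5, 7, 15], 0, ⟨-1, -5, -3, -7⟩),
   ([0, 1, 5, 13, 15], 0, ⟨-1, -7, -3, -5⟩),
   ([0, 1, 9, 11, 15], 0, ⟨-1, -5, -7, -3⟩),
   ([0, 1, 9, 13, 15], 0, ⟨-1, -7, -5, -3⟩),
   ([0, 2, 3, 7, 15], 0, ⟨-3, -1, -5, -7⟩),
   ([0, 2, 3, 11, 15], 0, ⟨-3, -1, -7, -5⟩),
   ([0, 2, 6, 7, 15], 0, ⟨-5, -1, -3, -7⟩),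
   ([0, 2, 6, 14, 15], 0, ⟨-7, -1, -3, -5⟩),
   ([0, 2, 10, 11, 15], 0, ⟨-5, -1, -7, -3⟩),
   ([0, 2, 10, 14, 15], 0, ⟨-7, -1, -5, -3⟩),
   ([0, 4, 5, 7, 15], 0, ⟨-3, -5, -1, -7⟩),
   ([0, 4, 5, 13, 15], 0, ⟨-3, -7, -1, -5⟩),
   ([0, 4, 6, 7, 15], 0, ⟨-5, -3, -1, -7⟩),
   ([0, 4, 6, 14, 15], 0, ⟨-7, -3, -1, -5⟩),
   ([0, 4, 12, 13, 15], 0, ⟨-5, -7, -1, -3⟩),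
   ([0, 4, 12, 14, 15], 0, ⟨-7, -5, -1, -3⟩),
   ([0, 8, 9, 11, 15], 0, ⟨-3, -5, -7, -1⟩),
   ([0, 8, 9, 13, 15], 0, ⟨-3, -7, -5, -1⟩),
   ([0, 8, 10, 11, 15], 0, ⟨-5, -3, -7, -1⟩),
   ([0, 8, 10, 14, 15], 0, ⟨-7, -3, -5, -1⟩),
   ([0, 8, 12, 13, 15], 0, ⟨-5, -7, -3, -1⟩),
   ([0, 8, 12, 14, 15], 0, ⟨-7, -5, -3, -1⟩)]

/-- The simplices of the cone triangulation, with the affine functions interpolating `coneHeight`. -/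
def coneRows : List (List ℕ × ℤ × IVec) :=
  [([0, 1, 2, 4, 8], 1, ⟨-1, -1, -1, -1⟩),
   ([1, 2, 4, 8, 15], 0, ⟨0, 0, 0, 0⟩),
   ([2, 4, 8, 14, 15], -1, ⟨-2, 1, 1, 1⟩),
   ([4, 8, 12, 14, 15], -2, ⟨-2, 0, 2, 2⟩),
   ([2, 8, 10, 14, 15], -2, ⟨-2, 2, 0, 2⟩),
   ([2, 4, 6, 14, 15], -2, ⟨-2, 2, 2, 0⟩),
   ([1, 4, 8, 13, 15], -1, ⟨1, -2, 1, 1⟩),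
   ([4, 8, 12, 13, 15], -2, ⟨0, -2, 2, 2⟩),
   ([1, 8, 9, 13, 15], -2, ⟨2, -2, 0, 2⟩),
   ([1, 4, 5, 13, 15], -2, ⟨2, -2, 2, 0⟩),
   ([1, 2, 8, 11, 15], -1, ⟨1, 1, -2, 1⟩),
   ([2, 8, 10, 11, 15], -2, ⟨0, 2, -2, 2⟩),
   ([1, 8, 9, 11, 15], -2, ⟨2, 0, -2, 2⟩),
   ([1, 2, 3, 11, 15], -2, ⟨2, 2, -2, 0⟩),
   ([1, 2, 4, 7, 15], -1, ⟨1, 1, 1, -2⟩),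
   ([2, 4, 6, 7, 15], -2, ⟨0, 2, 2, -2⟩),
   ([1, 4, 5, 7, 15], -2, ⟨2, 0, 2, -2⟩),
   ([1, 2, 3, 7, 15], -2, ⟨2, 2, 0, -2⟩)]

/-- Minus the square of the number of ones is strictly submodular; its lower hull is the Lovász
extension, linear exactly along chains of subsets. -/
def standardHeight (k : ℕ) : ℤ :=
  -((if k.testBit 0 then 1 else 0) + (if k.testBit 1 then 1 else 0) +
    (if k.testBit 2 then 1 else 0) + if k.testBit 3 then 1 else 0) ^ 2

/-- The antipodal simplex sits at height 0 and every other vertex strictly above it. -/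
def coneHeight (k : ℕ) : ℤ :=
  if k = 0 then 1 else if k = 1 ∨ k = 2 ∨ k = 4 ∨ k = 8 ∨ k = 15 then 0 else 2

def rowMasks (rows : List (List ℕ × ℤ × IVec)) : List ℕ := rows.map fun r => mask r.1

/-- Finite conditions under which the simplices listed in `rows`, with the given affine functions,
form a lifted nonobtuse triangulation, unique among those meeting it. -/
structure TableOK (rows : List (List ℕ × ℤ × IVec)) (h : ℕ → ℤ) : Prop where
  ne_nil : rows ≠ []
  length : ∀ r ∈ rows, r.1.length = 5 ∧ r.1.Nodup ∧ ∀ k ∈ r.1, k < 16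
  strict : ∀ r ∈ rows, strictCheck r.1 = true
  lift : ∀ r ∈ rows, ∀ k < 16, if k ∈ r.1 then affineEval r.2.1 r.2.2 k = h k
    else affineEval r.2.1 r.2.2 k < h k
  neighbor : ∀ r ∈ rows, ∀ k ∈ r.1, interiorCheck (r.1.erase k) = true →
    ∃ u < 16, u ∉ r.1 ∧ mask (u :: r.1.erase k) ∈ rowMasks rows
  closed : ∀ r ∈ rows, ∀ k ∈ r.1, interiorCheck (r.1.erase k) = true →
    ∀ u < 16, u ∉ r.1 → weakCheck (u :: r.1.erase k) = true →
      mask (u :: r.1.erase k) ∈ rowMasks rows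

set_option maxRecDepth 100000

lemma standardRows_ok : TableOK standardRows standardHeight := by
  constructor <;> decide +kernel

lemma coneRows_ok : TableOK coneRows coneHeight := by
  constructor <;> decide +kernel

lemma standardTriangulation_eq :
    standardTriangulation 4 = (standardRows.map fun r => decS r.1).toFinset := by
  decide +kernel

lemma coneTriangulation_eq :
    coneTriangulation 4 = (coneRows.map fun r => decS r.1).toFinset := by
  decide +kernel

/-- A reflection of the 4-cube takes the simplex with codes in `L` into one of the two tables. -/
def reflectsToTable (L : List ℕ) : Bool :=
  (List.range 16).any fun t =>
    (rowMasks standardRows ++ rowMasks coneRows).contains (mask (L.map fun k => k ^^^ t))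

/-- Up to reflections, the only nonobtuse simplices at the origin are those of the two tables. -/
lemma classification_codes : ∀ e < 16, ∀ d < e, ∀ c < d, ∀ b < c, 0 < b →
    (!weakCheck [0, b, c, d, e] || reflectsToTable [0, b, c, d, e]) = true := by
  decide +kernel

/-! ### Passing between codes and vertices -/

lemma enc_decV : ∀ k < 16, enc (decV k) = k := by decide +kernel

lemma decV_enc : ∀ v : CubeVertex 4, enc v < 16 ∧ decV (enc v) = v := by decide +kernel

lemma decV_injOn {k l : ℕ} (hk : k < 16) (hl : l < 16) (h : decV k = decV l) : k = l := by
  rw [← enc_decV k hk, h, enc_decV l hl]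

lemma mem_decS {L : List ℕ} {v : CubeVertex 4} : v ∈ decS L ↔ ∃ k ∈ L, decV k = v := by
  simp [decS]

lemma decV_mem_decS {L : List ℕ} (hL : ∀ k ∈ L, k < 16) {u : ℕ} (hu : u < 16) :
    decV u ∈ decS L ↔ u ∈ L := by
  rw [mem_decS]
  constructor
  · rintro ⟨k, hk, h⟩
    rwa [← decV_injOn (hL k hk) hu h]
  · exact fun h => ⟨u, h, rfl⟩

lemma testBit_mask (L : List ℕ) (k : ℕ) : (mask L).testBit k = true ↔ k ∈ L := by
  induction L with
  | nil => simp [mask]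
  | cons a L ih =>
    simp only [mask, Nat.testBit_or, Bool.or_eq_true, ih, Nat.testBit_two_pow, List.mem_cons,
      decide_eq_true_eq, @eq_comm _ a]

lemma decS_eq_of_mask {L L' : List ℕ} (h : mask L = mask L') : decS L = decS L' := by
  ext v
  simp only [mem_decS, ← testBit_mask, h]

lemma decS_cons (k : ℕ) (L : List ℕ) : decS (k :: L) = insert (decV k) (decS L) := by
  simp [decS]

lemma decS_erase {L : List ℕ} (hL : ∀ k ∈ L, k < 16) (hnd : L.Nodup) {k : ℕ} (hk : k ∈ L) :
    (decS L).erase (decV k) = decS (L.erase k) := by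
  ext v
  simp only [mem_erase, mem_decS, hnd.mem_erase_iff]
  constructor
  · rintro ⟨hv, l, hl, rfl⟩
    exact ⟨l, ⟨fun h => hv (h ▸ rfl), hl⟩, rfl⟩
  · rintro ⟨l, ⟨hlk, hl⟩, rfl⟩
    exact ⟨fun h => hlk (decV_injOn (hL l hl) (hL k hk) h), l, hl, rfl⟩

lemma card_decS {L : List ℕ} (hL : ∀ k ∈ L, k < 16) (hnd : L.Nodup) :
    (decS L).card = L.length := by
  rw [decS, List.toFinset_card_of_nodup, List.length_map]
  exact hnd.map_on fun x hx y hy h => decV_injOn (hL x hx) (hL y hy) h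

lemma interiorCheck_of {L : List ℕ} (h : ¬ InCubeFacet (decS L)) : interiorCheck L = true := by
  simp only [InCubeFacet, not_exists, not_forall, mem_decS] at h
  simp only [interiorCheck, List.all_eq_true, List.mem_range, Bool.and_eq_true, List.any_eq_true]
  intro i hi
  constructor
  · obtain ⟨_, ⟨k, hk, rfl⟩, h⟩ := h ⟨i, hi⟩ false
    exact ⟨k, hk, by simpa [decV] using h⟩
  · obtain ⟨_, ⟨k, hk, rfl⟩, h⟩ := h ⟨i, hi⟩ true
    exact ⟨k, hk, by simpa [decV] using h⟩

/-! ### Cross products as facet normals -/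

namespace IVec

/-- An integer vector as a point of Euclidean space. -/
def toE (q : IVec) : EuclideanSpace ℝ (Fin 4) := !₂[(q.x : ℝ), (q.y : ℝ), (q.z : ℝ), (q.w : ℝ)]

lemma inner_toE (q r : IVec) : inner ℝ q.toE r.toE = (q.dot r : ℝ) := by
  simp [toE, dot, PiLp.inner_apply, Fin.sum_univ_four]
  ring

lemma toE_sub (q r : IVec) : (q.sub r).toE = q.toE - r.toE := by
  ext i
  fin_cases i <;> simp [toE, sub]

lemma toE_eq_zero {q : IVec} (h : q.toE = 0) : q = ⟨0, 0, 0, 0⟩ := by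
  have h0 : ∀ i, q.toE i = 0 := fun i => by rw [h]; rfl
  have h1 := h0 0
  have h2 := h0 1
  have h3 := h0 2
  have h4 := h0 3
  simp [toE] at h1 h2 h3 h4
  ext <;> simpa

end IVec

lemma pt_decV (k : ℕ) : pt (decV k) = (IVec.ofCode k).toE := by
  ext i
  rw [pt_apply]
  fin_cases i <;> simp [decV, IVec.toE, IVec.ofCode] <;> rfl

lemma inner_facetNormal (w p q r u : ℕ) :
    inner ℝ (facetNormal w p q r).toE (pt (decV u) - pt (decV w)) = (volume u w p q r : ℝ) := by
  rw [pt_decV, pt_decV, ← IVec.toE_sub, IVec.inner_toE, volume]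

lemma volume_eq_zero (w p q r : ℕ) :
    volume w w p q r = 0 ∧ volume p w p q r = 0 ∧ volume q w p q r = 0 ∧ volume r w p q r = 0 := by
  simp only [volume, facetNormal, IVec.cross, IVec.dot, IVec.sub, IVec.det3]
  refine ⟨?_, ?_, ?_, ?_⟩ <;> ring

lemma inner_facetNormal_of_mem {w p q r : ℕ} {x : CubeVertex 4} (hx : x ∈ decS [w, p, q, r]) :
    inner ℝ (facetNormal w p q r).toE (pt x - pt (decV w)) = 0 := by
  obtain ⟨k, hk, rfl⟩ := mem_decS.1 hx
  obtain ⟨h1, h2, h3, h4⟩ := volume_eq_zero w p q r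
  rw [inner_facetNormal]
  simp only [List.mem_cons, List.not_mem_nil, or_false] at hk
  rcases hk with rfl | rfl | rfl | rfl <;> simp [*]

lemma isOutwardNormal_facet {S : Finset (CubeVertex 4)} {v w p q r : ℕ}
    (hS : S = decS [v, w, p, q, r]) (hvol : volume v w p q r ≠ 0) :
    IsOutwardNormal S (decV v) (-(volume v w p q r : ℝ) • (facetNormal w p q r).toE) := by
  have h0 : ∀ x ∈ S, x ≠ decV v →
      inner ℝ (facetNormal w p q r).toE (pt x - pt (decV w)) = 0 := by
    intro x hx hxv
    rw [hS, decS_cons, mem_insert] at hx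
    exact inner_facetNormal_of_mem (hx.resolve_left hxv)
  refine ⟨fun x hx y hy hxv hyv => ?_, fun x hx hxv => ?_⟩
  · rw [real_inner_smul_left, ← sub_sub_sub_cancel_right _ _ (pt (decV w)), inner_sub_right,
      h0 x hx hxv, h0 y hy hyv, sub_self, mul_zero]
  · rw [real_inner_smul_left, ← sub_sub_sub_cancel_right _ _ (pt (decV w)), inner_sub_right,
      h0 x hx hxv, inner_facetNormal, sub_zero]
    have : (volume v w p q r : ℝ) ≠ 0 := by exact_mod_cast hvol
    nlinarith [mul_self_pos.2 this]

/-- With zero volume, pairing with the normal gives an affine function vanishing at all five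
vertices, hence everywhere, so the normal is zero. Allowing this alternative in `VolumeOK` avoids
proving that the normal is nonzero. -/
lemma volumeOK_of_isBinarySimplex {S : Finset (CubeVertex 4)} (hs : IsBinarySimplex S)
    {v w p q r : ℕ} (hS : S = decS [v, w, p, q, r]) : VolumeOK v w p q r := by
  by_contra h
  rw [VolumeOK, not_or, not_not] at h
  obtain ⟨β, hβ⟩ := hs.exists_isBarycentric
  set N := (facetNormal w p q r).toE with hN
  let f : EuclideanSpace ℝ (Fin 4) →ᵃ[ℝ] ℝ :=
    (innerSL ℝ N).toLinearMap.toAffineMap - AffineMap.const ℝ _ (inner ℝ N (pt (decV w)))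
  have hf : ∀ y, f y = inner ℝ N (y - pt (decV w)) := fun y => by
    simp [f, inner_sub_right]
  have hzero : ∀ y, inner ℝ N (y - pt (decV w)) = 0 := by
    intro y
    rw [← hf, hβ.affine_apply f y]
    refine sum_eq_zero fun u hu => ?_
    rw [hS, decS_cons, mem_insert] at hu
    rw [hf]
    rcases hu with rfl | hu
    · rw [hN, inner_facetNormal, h.1, Int.cast_zero, mul_zero]
    · rw [hN, inner_facetNormal_of_mem hu, mul_zero]
  have h1 := hzero (N + pt (decV w))
  rw [add_sub_cancel_right, inner_self_eq_zero] at h1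
  exact h.2 (IVec.toE_eq_zero h1)

lemma decS_swap (v w : ℕ) (L : List ℕ) : decS (v :: w :: L) = decS (w :: v :: L) := by
  rw [decS_cons, decS_cons, decS_cons, decS_cons, insert_comm]

/-- The factor `-volume` turns a cross product of either orientation into an outward normal, so the
integer tested by `DihedralOK` is an inner product of outward normals. -/
lemma inner_facetNormal_smul (v w p q r : ℕ) :
    inner ℝ (-(volume v w p q r : ℝ) • (facetNormal w p q r).toE)
      (-(volume w v p q r : ℝ) • (facetNormal v p q r).toE) =
    ((volume v w p q r * volume w v p q r *
      (facetNormal w p q r).dot (facetNormal v p q r) : ℤ) : ℝ) := by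
  rw [real_inner_smul_left, real_inner_smul_right, IVec.inner_toE]
  push_cast
  ring

lemma dihedralOK_of_isNonobtuse {S : Finset (CubeVertex 4)} (hs : IsNonobtuse S)
    {v w p q r : ℕ} (hS : S = decS [v, w, p, q, r]) (hvw : decV v ≠ decV w) :
    DihedralOK v w p q r := by
  rw [DihedralOK]
  by_cases hv : volume v w p q r = 0
  · simp [hv]
  by_cases hw : volume w v p q r = 0
  · simp [hw]
  have h := hs (decV v) (by rw [hS]; simp [decS]) (decV w) (by rw [hS]; simp [decS]) hvw _ _
    (isOutwardNormal_facet hS hv) (isOutwardNormal_facet (hS.trans (decS_swap _ _ _)) hw)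
  rw [nonobtuse_angle_iff, inner_facetNormal_smul] at h
  exact_mod_cast h

lemma exists_rest {L : List ℕ} (hlen : L.length = 5) {v w : ℕ} (hv : v ∈ L)
    (hw : w ∈ L) (hvw : v ≠ w) : ∃ p q r, (L.erase v).erase w = [p, q, r] ∧
      decS L = decS [v, w, p, q, r] := by
  have hw' : w ∈ L.erase v := (List.mem_erase_of_ne hvw.symm).2 hw
  have hl : ((L.erase v).erase w).length = 3 := by
    rw [List.length_erase_of_mem hw', List.length_erase_of_mem hv, hlen]
  obtain ⟨p, q, r, h⟩ := List.length_eq_three.1 hl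
  refine ⟨p, q, r, h, ?_⟩
  have hperm : L.Perm (v :: w :: [p, q, r]) :=
    (List.perm_cons_erase hv).trans ((h ▸ List.perm_cons_erase hw').cons v)
  exact List.toFinset_eq_of_perm _ _ (hperm.map decV)

lemma weakCheck_of {L : List ℕ} (hlen : L.length = 5) (hL : ∀ k ∈ L, k < 16)
    (hs : IsBinarySimplex (decS L)) (ho : IsNonobtuse (decS L)) : weakCheck L = true := by
  simp only [weakCheck, List.all_eq_true, Bool.or_eq_true, beq_iff_eq]
  intro v hv w hw
  refine or_iff_not_imp_left.2 fun hvw => ?_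
  obtain ⟨p, q, r, h, hS⟩ := exists_rest hlen hv hw hvw
  rw [h, weakPair, Bool.and_eq_true, decide_eq_true_eq, decide_eq_true_eq]
  exact ⟨volumeOK_of_isBinarySimplex hs hS,
    dihedralOK_of_isNonobtuse ho hS fun h => hvw (decV_injOn (hL v hv) (hL w hw) h)⟩

lemma strictCheck_spec {L : List ℕ} (h : strictCheck L = true) {v w : ℕ} (hv : v ∈ L)
    (hw : w ∈ L) (hvw : v ≠ w) {p q r : ℕ} (hpqr : (L.erase v).erase w = [p, q, r]) :
    volume v w p q r ≠ 0 ∧ DihedralOK v w p q r := by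
  simp only [strictCheck, List.all_eq_true, Bool.or_eq_true, beq_iff_eq] at h
  have := (h v hv w hw).resolve_left hvw
  rwa [hpqr, strictPair, Bool.and_eq_true, decide_eq_true_eq, decide_eq_true_eq] at this

lemma exists_mem_ne {L : List ℕ} (hlen : L.length = 5) (hnd : L.Nodup) {v : ℕ}
    (hv : v ∈ L) : ∃ w ∈ L, v ≠ w := by
  have hl : (L.erase v).length = 4 := by rw [List.length_erase_of_mem hv, hlen]
  obtain ⟨w, hw⟩ := List.exists_mem_of_length_pos (l := L.erase v) (by omega)
  rw [hnd.mem_erase_iff] at hw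
  exact ⟨w, hw.2, hw.1.symm⟩

/-- The normals of the facets, read as affine functions, form a dual system for the vertices. -/
lemma isBinarySimplex_of_strictCheck {L : List ℕ} (hlen : L.length = 5) (hnd : L.Nodup)
    (hL : ∀ k ∈ L, k < 16) (h : strictCheck L = true) : IsBinarySimplex (decS L) := by
  have key : ∀ u ∈ decS L, ∃ f : EuclideanSpace ℝ (Fin 4) →ᵃ[ℝ] ℝ, f (pt u) ≠ 0 ∧
      ∀ x ∈ decS L, u ≠ x → f (pt x) = 0 := by
    intro u hu
    obtain ⟨v, hv, rfl⟩ := mem_decS.1 hu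
    obtain ⟨w, hw, hvw⟩ := exists_mem_ne hlen hnd hv
    obtain ⟨p, q, r, hpqr, hS⟩ := exists_rest hlen hv hw hvw
    have hvol := (strictCheck_spec h hv hw hvw hpqr).1
    set N := (facetNormal w p q r).toE with hN
    let f : EuclideanSpace ℝ (Fin 4) →ᵃ[ℝ] ℝ :=
      (innerSL ℝ N).toLinearMap.toAffineMap - AffineMap.const ℝ _ (inner ℝ N (pt (decV w)))
    have hf : ∀ y, f y = inner ℝ N (y - pt (decV w)) := fun y => by
      simp [f, inner_sub_right]
    refine ⟨f, ?_, fun x hx hxv => ?_⟩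
    · rw [hf, hN, inner_facetNormal]
      exact_mod_cast hvol
    · rw [hS, decS_cons, mem_insert] at hx
      rw [hf, hN, inner_facetNormal_of_mem (hx.resolve_left hxv.symm)]
  choose! f hf hf' using key
  exact IsBinarySimplex.of_dual (by rw [card_decS hL hnd, hlen]) f hf hf'

lemma isNonobtuse_of_strictCheck {L : List ℕ} (hlen : L.length = 5) (hnd : L.Nodup)
    (hL : ∀ k ∈ L, k < 16) (h : strictCheck L = true) : IsNonobtuse (decS L) := by
  have hs := isBinarySimplex_of_strictCheck hlen hnd hL h
  intro v' hv' w' hw' hvw' q r hq hr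
  obtain ⟨v, hv, rfl⟩ := mem_decS.1 hv'
  obtain ⟨w, hw, rfl⟩ := mem_decS.1 hw'
  have hvw : v ≠ w := fun h => hvw' (h ▸ rfl)
  obtain ⟨a, b, c, habc, hS⟩ := exists_rest hlen hv hw hvw
  obtain ⟨a', b', c', habc', hS'⟩ := exists_rest hlen hw hv hvw.symm
  rw [List.erase_comm, habc] at habc'
  obtain ⟨rfl, rfl, rfl⟩ : a = a' ∧ b = b' ∧ c = c' := by simpa using habc'
  obtain ⟨h1, h2⟩ := strictCheck_spec h hv hw hvw habc
  have h3 := (strictCheck_spec h hw hv hvw.symm (by rw [List.erase_comm, habc])).1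
  -- Arbitrary outward normals are positive multiples of the computed ones, which leaves the sign
  -- unchanged.
  obtain ⟨s, hs0, rfl⟩ := hq.exists_smul four_ne_zero hs hv' (isOutwardNormal_facet hS h1)
  obtain ⟨t, ht0, rfl⟩ := hr.exists_smul four_ne_zero hs hw' (isOutwardNormal_facet hS' h3)
  rw [nonobtuse_angle_iff, real_inner_smul_left, real_inner_smul_right, inner_facetNormal_smul]
  have h4 : ((volume v w a b c * volume w v a b c *
      (facetNormal w a b c).dot (facetNormal v a b c) : ℤ) : ℝ) ≤ 0 := by
    exact_mod_cast h2
  exact mul_nonpos_of_nonneg_of_nonpos hs0.le (mul_nonpos_of_nonneg_of_nonpos ht0.le h4)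

/-! ### From tables to triangulations: existence and rigidity -/

/-- The set of simplices listed in `rows`. -/
def rowSet (rows : List (List ℕ × ℤ × IVec)) : Finset (Finset (CubeVertex 4)) :=
  (rows.map fun r => decS r.1).toFinset

lemma mem_rowSet {rows : List (List ℕ × ℤ × IVec)} {S : Finset (CubeVertex 4)} :
    S ∈ rowSet rows ↔ ∃ r ∈ rows, decS r.1 = S := by
  simp [rowSet]

lemma mem_rowSet_of_mask {rows : List (List ℕ × ℤ × IVec)} {L : List ℕ}
    (h : mask L ∈ rowMasks rows) : decS L ∈ rowSet rows := by
  obtain ⟨r, hr, h⟩ := List.mem_map.1 h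
  exact mem_rowSet.2 ⟨r, hr, decS_eq_of_mask h⟩

namespace TableOK

variable {rows : List (List ℕ × ℤ × IVec)} {h : ℕ → ℤ}

lemma isLift (hr : TableOK rows h) : IsLift (rowSet rows) fun v => (h (enc v) : ℝ) := by
  intro S hS
  obtain ⟨⟨L, c, N⟩, hrow, rfl⟩ := mem_rowSet.1 hS
  let f : EuclideanSpace ℝ (Fin 4) →ᵃ[ℝ] ℝ :=
    (innerSL ℝ N.toE).toLinearMap.toAffineMap + AffineMap.const ℝ _ (c : ℝ)
  have hf : ∀ k, f (pt (decV k)) = (affineEval c N k : ℝ) := fun k => by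
    rw [affineEval, Int.cast_add, ← IVec.inner_toE, ← pt_decV]
    simp [f, add_comm]
  have hL := (hr.length _ hrow).2.2
  have hlift := hr.lift _ hrow
  refine ⟨f, fun v hv => ?_, fun v hv => ?_⟩ <;> beta_reduce
  · obtain ⟨hv16, hdec⟩ := decV_enc v
    rw [← hdec, decV_mem_decS hL hv16] at hv
    have := hlift _ hv16
    rw [if_pos hv] at this
    rw [← this, ← hf, hdec]
  · obtain ⟨hv16, hdec⟩ := decV_enc v
    rw [← hdec, decV_mem_decS hL hv16] at hv
    have := hlift _ hv16
    rw [if_neg hv] at this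
    rw [← hdec, hf, hdec]
    exact_mod_cast this

lemma isBinarySimplex (hr : TableOK rows h) {S : Finset (CubeVertex 4)} (hS : S ∈ rowSet rows) :
    IsBinarySimplex S := by
  obtain ⟨r, hrow, rfl⟩ := mem_rowSet.1 hS
  obtain ⟨h1, h2, h3⟩ := hr.length _ hrow
  exact isBinarySimplex_of_strictCheck h1 h2 h3 (hr.strict _ hrow)

lemma isNonobtuseBinaryTriangulation (hr : TableOK rows h) :
    IsNonobtuseBinaryTriangulation (rowSet rows) := by
  refine ⟨⟨fun S => hr.isBinarySimplex, ?_, fun S hS S' hS' => hr.isLift.face_to_face hS hS'⟩, ?_⟩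
  · refine Set.Subset.antisymm (Set.iUnion₂_subset fun S _ => hull_subset_cube S) ?_
    refine hr.isLift.cover ?_ (fun S => hr.isBinarySimplex) fun S hS v hv hF => ?_
    · obtain ⟨r, hrow⟩ := List.exists_mem_of_ne_nil _ hr.ne_nil
      exact ⟨_, mem_rowSet.2 ⟨r, hrow, rfl⟩⟩
    · obtain ⟨r, hrow, rfl⟩ := mem_rowSet.1 hS
      obtain ⟨k, hk, rfl⟩ := mem_decS.1 hv
      obtain ⟨-, hnd, hL⟩ := hr.length _ hrow
      rw [decS_erase hL hnd hk] at hF ⊢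
      obtain ⟨u, hu16, hu, hmask⟩ := hr.neighbor _ hrow k hk (interiorCheck_of hF)
      refine ⟨decV u, fun hmem => hu ((decV_mem_decS hL hu16).1 hmem), ?_⟩
      rw [← decS_cons]
      exact mem_rowSet_of_mask hmask
  · intro S hS
    obtain ⟨r, hrow, rfl⟩ := mem_rowSet.1 hS
    obtain ⟨h1, h2, h3⟩ := hr.length _ hrow
    exact isNonobtuse_of_strictCheck h1 h2 h3 (hr.strict _ hrow)

/-- A nonobtuse triangulation is determined by any of its simplices that is in the table. -/
lemma eq_of_mem (hr : TableOK rows h) {T : Finset (Finset (CubeVertex 4))}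
    (hT : IsNonobtuseBinaryTriangulation T) {S : Finset (CubeVertex 4)} (hS : S ∈ T)
    (hS' : S ∈ rowSet rows) : T = rowSet rows := by
  -- A neighbour in `T` of a table simplex is nonobtuse, so it passes `weakCheck` and `closed`
  -- returns it to the table.
  have hcov : cube 4 ⊆ ⋃ R ∈ T ∩ rowSet rows, hull R := by
    refine (hr.isLift.mono inter_subset_right).cover ⟨S, mem_inter.2 ⟨hS, hS'⟩⟩
      (fun R hR => hr.isBinarySimplex (mem_inter.1 hR).2) fun R hR v hv hF => ?_
    obtain ⟨hRT, hR⟩ := mem_inter.1 hR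
    obtain ⟨w, hw, hwT⟩ := hT.1.exists_neighbor four_ne_zero hRT hv hF
    refine ⟨w, hw, mem_inter.2 ⟨hwT, ?_⟩⟩
    obtain ⟨r, hrow, rfl⟩ := mem_rowSet.1 hR
    obtain ⟨k, hk, rfl⟩ := mem_decS.1 hv
    obtain ⟨hlen, hnd, hL⟩ := hr.length _ hrow
    obtain ⟨hu16, hdec⟩ := decV_enc w
    rw [decS_erase hL hnd hk] at hF hwT ⊢
    rw [← hdec] at hw hwT ⊢
    rw [decV_mem_decS hL hu16] at hw
    rw [← decS_cons] at hwT ⊢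
    refine mem_rowSet_of_mask (hr.closed _ hrow k hk (interiorCheck_of hF) _ hu16 hw ?_)
    refine weakCheck_of ?_ ?_ (hT.1.simplex _ hwT) (hT.2 _ hwT)
    · rw [List.length_cons, List.length_erase_of_mem hk, hlen]
    · intro l hl
      rcases List.mem_cons.1 hl with rfl | hl
      · exact hu16
      · exact hL l (List.mem_of_mem_erase hl)
  -- The intersection covers the cube, so it equals each of the two triangulations containing it.
  rw [← hT.1.eq_of_subset_of_cover inter_subset_left hcov]
  exact hr.isNonobtuseBinaryTriangulation.1.eq_of_subset_of_cover inter_subset_right hcov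

end TableOK

/-! ### Reduction to simplices at the origin -/

lemma decV_zero : decV 0 = origin 4 := by
  funext i
  simp [decV, origin]

lemma cubeSymmetry_decV (k t : ℕ) : cubeSymmetry 1 (decV t) (decV k) = decV (k ^^^ t) := by
  funext i
  simp [cubeSymmetry, decV]

lemma image_cubeSymmetry_decS (L : List ℕ) (t : ℕ) :
    (decS L).image (cubeSymmetry 1 (decV t)) = decS (L.map fun k => k ^^^ t) := by
  ext v
  simp [mem_decS, cubeSymmetry_decV]

/-- The vertices of a binary simplex at the origin, listed by increasing codes. -/
lemma exists_codes {S : Finset (CubeVertex 4)} (hcard : S.card = 5) (h0 : origin 4 ∈ S) :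
    ∃ b c d e, 0 < b ∧ b < c ∧ c < d ∧ d < e ∧ e < 16 ∧ S = decS [0, b, c, d, e] := by
  have hinj : Function.Injective enc := fun u v h => by
    rw [← (decV_enc u).2, h, (decV_enc v).2]
  have hK : (S.image enc).card = 5 := by rw [card_image_of_injective _ hinj, hcard]
  set f := (S.image enc).orderEmbOfFin hK with hf
  have hmem : ∀ k, k ∈ S.image enc ↔ ∃ i, f i = k := fun k => by
    rw [← mem_coe, ← range_orderEmbOfFin (S.image enc) hK, Set.mem_range]
  have hlt : ∀ i, f i < 16 := fun i => by
    obtain ⟨v, -, hv⟩ := mem_image.1 ((hmem (f i)).2 ⟨i, rfl⟩)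
    rw [← hv]; exact (decV_enc v).1
  -- The origin has code 0, necessarily the least.
  have hf0 : f 0 = 0 := by
    have : (0 : ℕ) ∈ S.image enc :=
      mem_image.2 ⟨_, h0, by rw [← decV_zero, enc_decV 0 (by norm_num)]⟩
    obtain ⟨i, hi⟩ := (hmem 0).1 this
    exact Nat.le_zero.1 (hi ▸ f.monotone (Fin.zero_le i))
  have hmono := f.strictMono
  refine ⟨f 1, f 2, f 3, f 4, hf0 ▸ hmono (by decide), hmono (by decide), hmono (by decide),
    hmono (by decide), hlt 4, ?_⟩
  ext v
  have h1 : v ∈ S ↔ ∃ i, f i = enc v := by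
    rw [← hmem, mem_image]
    exact ⟨fun h => ⟨v, h, rfl⟩, fun ⟨u, hu, huv⟩ => hinj huv ▸ hu⟩
  have h2 : ∀ i, f i = enc v ↔ decV (f i) = v := fun i =>
    ⟨fun h => by rw [h, (decV_enc v).2], fun h => by rw [← h, enc_decV _ (hlt i)]⟩
  simp only [h1, h2, mem_decS, Fin.exists_fin_succ, Fin.exists_fin_zero, List.mem_cons,
    List.not_mem_nil, or_false, exists_eq_or_imp, exists_eq_left, ← hf0]
  rfl

/-- Every nonobtuse simplex at the origin has a reflection in one of the two tables. -/
lemma exists_reflection {S : Finset (CubeVertex 4)} (hs : IsBinarySimplex S)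
    (ho : IsNonobtuse S) (h0 : origin 4 ∈ S) :
    ∃ b, S.image (cubeSymmetry 1 b) ∈ rowSet standardRows ∨
      S.image (cubeSymmetry 1 b) ∈ rowSet coneRows := by
  obtain ⟨b, c, d, e, h1, h2, h3, h4, h5, rfl⟩ := exists_codes hs.1 h0
  have hw := weakCheck_of (by rfl) (by simp; omega) hs ho
  have hcl := classification_codes e h5 d h4 c h3 b h2 h1
  rw [hw, Bool.not_true, Bool.false_or, reflectsToTable, List.any_eq_true] at hcl
  obtain ⟨t, -, ht⟩ := hcl
  rw [List.contains_iff_mem, List.mem_append] at ht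
  refine ⟨decV t, ?_⟩
  rw [image_cubeSymmetry_decS]
  exact ht.imp mem_rowSet_of_mask mem_rowSet_of_mask

lemma isCopyOf_refl {n : ℕ} (T : Finset (Finset (CubeVertex n))) : IsCopyOf T T := by
  refine ⟨1, fun _ => false, ?_⟩
  have : cubeSymmetry (1 : Equiv.Perm (Fin n)) (fun _ => false) = id := by
    funext v i
    simp [cubeSymmetry]
  simp [this]

lemma image_image_cubeSymmetry_one {n : ℕ} (T : Finset (Finset (CubeVertex n)))
    (b : Fin n → Bool) :
    (T.image fun S => S.image (cubeSymmetry 1 b)).image (fun S => S.image (cubeSymmetry 1 b)) =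
      T := by
  have h : cubeSymmetry (1 : Equiv.Perm (Fin n)) b ∘ cubeSymmetry 1 b = id :=
    (cubeSymmetry_one_involutive b).comp_self
  have h' : ((fun S : Finset (CubeVertex n) => S.image (cubeSymmetry 1 b)) ∘
      fun S => S.image (cubeSymmetry 1 b)) = id := by
    funext S
    rw [Function.comp_apply, image_image, h, image_id, id]
  rw [image_image, h', image_id]

/-- The reflection is its own inverse, and composing it with a symmetry only changes the reflection
bits by `xor`. -/
lemma IsCopyOf.of_reflection {n : ℕ} {T T₀ : Finset (Finset (CubeVertex n))} {b : Fin n → Bool}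
    (h : IsCopyOf (T.image fun S => S.image (cubeSymmetry 1 b)) T₀) : IsCopyOf T T₀ := by
  obtain ⟨σ, b', h⟩ := h
  refine ⟨σ, fun i => xor (b' i) (b i), ?_⟩
  have hcomp : cubeSymmetry 1 b ∘ cubeSymmetry σ b' =
      cubeSymmetry σ fun i => xor (b' i) (b i) := by
    funext v i
    simp [cubeSymmetry]
  rw [← image_image_cubeSymmetry_one T b, h, image_image]
  simp only [Function.comp_def, image_image]
  rw [← hcomp]
  rfl

end NonobtuseCube

end

theorem mainTheorem7
    (T : Finset (Finset (NonobtuseCube.CubeVertex 4))) :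
    NonobtuseCube.IsNonobtuseBinaryTriangulation T ↔
      (NonobtuseCube.IsCopyOf T (NonobtuseCube.standardTriangulation 4) ∨
        NonobtuseCube.IsCopyOf T (NonobtuseCube.coneTriangulation 4)) := by
  rw [NonobtuseCube.standardTriangulation_eq, NonobtuseCube.coneTriangulation_eq]
  constructor
  · intro hT
    obtain ⟨S, hS⟩ := hT.1.nonempty
    obtain ⟨v, hv⟩ := (hT.1.simplex S hS).nonempty
    -- Reflecting by the coordinates of `v` itself moves `v` to the origin.
    have hT' := hT.image_cubeSymmetry 1 v
    have hS' := Finset.mem_image_of_mem (fun S => S.image (NonobtuseCube.cubeSymmetry 1 v)) hS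
    have h0 : NonobtuseCube.origin 4 ∈ S.image (NonobtuseCube.cubeSymmetry 1 v) :=
      Finset.mem_image.2 ⟨v, hv, by funext i; simp [NonobtuseCube.cubeSymmetry,
        NonobtuseCube.origin]⟩
    obtain ⟨b, hb⟩ := NonobtuseCube.exists_reflection (hT'.1.simplex _ hS') (hT'.2 _ hS') h0
    have hT'' := hT'.image_cubeSymmetry 1 b
    have hS'' := Finset.mem_image_of_mem
      (fun S => S.image (NonobtuseCube.cubeSymmetry 1 b)) hS'
    refine hb.imp (fun hb => ?_) fun hb => ?_
    · refine .of_reflection (b := v) (.of_reflection (b := b) ?_)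
      rw [NonobtuseCube.standardRows_ok.eq_of_mem hT'' hS'' hb]
      exact NonobtuseCube.isCopyOf_refl _
    · refine .of_reflection (b := v) (.of_reflection (b := b) ?_)
      rw [NonobtuseCube.coneRows_ok.eq_of_mem hT'' hS'' hb]
      exact NonobtuseCube.isCopyOf_refl _
  · rintro (⟨σ, b, rfl⟩ | ⟨σ, b, rfl⟩)
    · exact NonobtuseCube.standardRows_ok.isNonobtuseBinaryTriangulation.image_cubeSymmetry σ b
    · exact NonobtuseCube.coneRows_ok.isNonobtuseBinaryTriangulation.image_cubeSymmetry σ b
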